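/- Let $C\subset\mathbb{R}^2$ be a compact convex set with the origin in its interior and let $S\subset\mathbb{R}^2$ be a finite set of points; no general position is assumed. Let $d_C(x,y)=\min\{\lambda\ge 0 : y\in x+\lambda C\}$ and, for $p\in S$, let $V'_C(p)=\{x\in\mathbb{R}^2 : d_C(x,p)\le d_C(x,q)\text{ for all } q\in S\}$. Let $p_1\prec p_2\prec\dots\prec p_n$ be the points of $S$ in lexicographical order, and define the Voronoi cells recursively by \[ V_C(p_i)=\mathrm{cl}\Bigl(\mathrm{int}\Bigl(V'_C(p_i)\setminus\bigcup_{j<i}V_C(p_j)\Bigr)\Bigr),\qquad 1\le i\le n. \] The Voronoi edges are the closures of the connected components of the set of points that lie in exactly two Voronoi cells. Let $DG_C(S)$ be the Delaunay graph: its vertex set is $S$, two distinct points $p,q\in S$ are adjacent if and only if $V_C(p)$ and $V_C(q)$ share a Voronoi edge (that is, some Voronoi edge is contained in both cells), and each edge $(p,q)$ is drawn as the closed line segment $pq$. Then $DG_C(S)$ is a plane graph: the relative interior of every edge contains no point of $S$ and no point of any other edge. In particular, no two distinct edges overlap in a segment or cross properly, and no edge passes through a point of $S$ other than its endpoints. 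-/

import Mathlib

open Set Topology

namespace ConvexDelaunay

/-- The Euclidean plane. -/
abbrev Plane : Type := EuclideanSpace ℝ (Fin 2)

/-- The homothet `x + l C` of `C`, with center `x` and scaling factor `l`. -/
def homothet (C : Set Plane) (x : Plane) (l : ℝ) : Set Plane :=
  (fun z : Plane => x + l • z) '' C

/-- The convex distance function `d_C(x, y)`: the least `l ≥ 0` with `y ∈ x + l C`. (For `C`
compact and convex with the origin in its interior this infimum is attained.) -/
noncomputable def convexDist (C : Set Plane) (x y : Plane) : ℝ :=
  sInf {l : ℝ | 0 ≤ l ∧ y ∈ homothet C x l}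

/-- The (strict) lexicographical order on the points of the plane. -/
def LexLT (p q : Plane) : Prop :=
  p 0 < q 0 ∨ (p 0 = q 0 ∧ p 1 < q 1)

theorem LexLT.irrefl (p : Plane) : ¬ LexLT p p := by
  rintro (h | ⟨_, h⟩) <;> exact lt_irrefl _ h

theorem LexLT.trans {p q r : Plane} (h : LexLT p q) (h' : LexLT q r) : LexLT p r := by
  unfold LexLT at *
  rcases h with h | ⟨h, h2⟩ <;> rcases h' with h' | ⟨h', h2'⟩
  · exact Or.inl (h.trans h')
  · exact Or.inl (h' ▸ h)
  · exact Or.inl (h ▸ h')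
  · exact Or.inr ⟨h.trans h', h2.trans h2'⟩

/-- The set `V'_C(p)` of all points for which `p` is a nearest point of `S`. -/
def nearestRegion (C : Set Plane) (S : Finset Plane) (p : Plane) : Set Plane :=
  {x | ∀ q ∈ S, convexDist C x p ≤ convexDist C x q}

/-- The Voronoi cells `V_C(p)`, by recursion along the lexicographical order of the points
of `S`: the closure of the interior of what is left of `V'_C(p)` after removing the cells
of all points of `S` that precede `p`. -/
noncomputable def voronoiCell (C : Set Plane) (S : Finset Plane) (p : Plane) : Set Plane :=
  closure (interior (nearestRegion C S p \
    ⋃ q : {q : Plane // q ∈ S ∧ LexLT q p}, voronoiCell C S q.1))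
termination_by {r : Plane | r ∈ S ∧ LexLT r p}.ncard
decreasing_by
  obtain ⟨q, hqS, hqp⟩ := q
  refine Set.ncard_lt_ncard ⟨fun r hr => ⟨hr.1, hr.2.trans hqp⟩, fun h => ?_⟩
    (S.finite_toSet.subset fun r hr => hr.1)
  exact LexLT.irrefl q (h (show q ∈ {r : Plane | r ∈ S ∧ LexLT r p} from ⟨hqS, hqp⟩)).2

/-- The points that lie in the Voronoi cells of exactly two points of `S`. (Points in only one
cell are the interior points of the cells, points in three or more cells are the Voronoi
vertices.) -/
def edgePoints (C : Set Plane) (S : Finset Plane) : Set Plane :=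
  {x | {p : Plane | p ∈ S ∧ x ∈ voronoiCell C S p}.ncard = 2}

/-- The Voronoi edges: the closures of the connected components of the set of points that lie
in exactly two Voronoi cells. -/
def IsVoronoiEdge (C : Set Plane) (S : Finset Plane) (e : Set Plane) : Prop :=
  ∃ x ∈ edgePoints C S, e = closure (connectedComponentIn (edgePoints C S) x)

/-- The Delaunay graph `DG_C(S)`, with vertex set `S`: two distinct points of `S` are adjacent
if and only if their Voronoi cells share a Voronoi edge. -/
def delaunayGraph (C : Set Plane) (S : Finset Plane) : SimpleGraph {p : Plane // p ∈ S} where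
  Adj p q := p ≠ q ∧
    ∃ e, IsVoronoiEdge C S e ∧ e ⊆ voronoiCell C S p.1 ∧ e ⊆ voronoiCell C S q.1
  symm := ⟨fun _ _ ⟨hne, e, he, hp, hq⟩ => ⟨hne.symm, e, he, hq, hp⟩⟩
  loopless := ⟨fun _ h => h.1 rfl⟩

/-- A geometric graph on a set `S` of points of the plane (every edge is drawn as the closed
segment between its endpoints) is plane if the relative interior of an edge contains no vertex
and no point of any other edge. -/
def IsPlaneGraph {S : Finset Plane} (G : SimpleGraph {p : Plane // p ∈ S}) : Prop :=
  (∀ p q : {p : Plane // p ∈ S}, G.Adj p q → ∀ v ∈ S, v ∉ openSegment ℝ p.1 q.1) ∧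
  (∀ p q r s : {p : Plane // p ∈ S}, G.Adj p q → G.Adj r s → s(p, q) ≠ s(r, s) →
    Disjoint (openSegment ℝ p.1 q.1) (segment ℝ r.1 s.1))

end ConvexDelaunay

namespace ConvexDelaunay

open scoped Pointwise

/-! The convex distance from `x` to `y` is `gauge C (y - x)`: it satisfies the triangle inequality
and is additive along a straight segment towards a site. With the lexicographic tie-breaking, this
makes every cell star-shaped about its site (`starConvex_voronoiCell`), even where a bisector has
nonempty interior.

An edge `pq` has a witness `x` that lies in the cells of `p` and `q` and in no other cell, so the
bent path `p x q` stays in these two cells. For edges `pq` and `rs` without common endpoint and with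
witnesses `x` and `y`, the paths `p x q` and `r y s` are disjoint (`disjoint_segment`). If the
straight edges crossed, the paths would have to meet, unless an endpoint of one edge lay in the
triangle spanned by the other path (`polylines_meet`). No site is closer to `x` than `p` and `q`
are, which excludes such an endpoint (`not_memTriangle`).

The delicate case is a site on the open segment `pq`, where distances alone give no contradiction;
there the tie-breaking decides (`not_mem_openSegment`). This also settles collinear edges and edges
with a common endpoint. -/

/-- A compact convex neighbourhood of the origin. -/
structure IsConvexBody (C : Set Plane) : Prop where
  isCompact : IsCompact C
  convex : Convex ℝ C
  zero_mem_interior : (0 : Plane) ∈ interior C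

theorem mem_homothet {C : Set Plane} {x y : Plane} {l : ℝ} :
    y ∈ homothet C x l ↔ y - x ∈ l • C := by
  simp only [homothet, mem_image, Set.mem_smul_set]
  refine exists_congr fun z => and_congr_right fun _ => ?_
  rw [eq_sub_iff_add_eq, add_comm]

/-! ### The convex distance as a gauge. -/

namespace IsConvexBody

variable {C : Set Plane} {S : Finset Plane}

theorem mem_nhds (hC : IsConvexBody C) : C ∈ 𝓝 (0 : Plane) :=
  mem_interior_iff_mem_nhds.1 hC.zero_mem_interior

theorem gauge_add_le (hC : IsConvexBody C) (u v : Plane) :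
    gauge C (u + v) ≤ gauge C u + gauge C v :=
  _root_.gauge_add_le hC.convex (absorbent_nhds_zero hC.mem_nhds) u v

theorem gauge_pos (hC : IsConvexBody C) {u : Plane} (hu : u ≠ 0) : 0 < gauge C u :=
  (_root_.gauge_pos (absorbent_nhds_zero hC.mem_nhds)
    ((NormedSpace.isVonNBounded_iff ℝ).2 hC.isCompact.isBounded)).2 hu

theorem continuous_gauge (hC : IsConvexBody C) : Continuous (gauge C) :=
  _root_.continuous_gauge hC.convex hC.mem_nhds

/-- The gauge only admits positive factors, but the factor `0` reaches nothing except the center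
itself, so the two infima differ at most in the case `y = x`, where both are `0`. -/
theorem convexDist_eq_gauge (hC : IsConvexBody C) (x y : Plane) :
    convexDist C x y = gauge C (y - x) := by
  have hbdd (P : ℝ → Prop) : BddBelow {l : ℝ | 0 ≤ l ∧ P l} := ⟨0, fun l hl => hl.1⟩
  by_cases hxy : y = x
  · subst hxy
    rw [sub_self, gauge_zero]
    refine le_antisymm (csInf_le (hbdd _) ⟨le_rfl, ?_⟩) (Real.sInf_nonneg fun l hl => hl.1)
    exact ⟨0, interior_subset hC.zero_mem_interior, by simp⟩
  · rw [gauge_def, convexDist]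
    congr 1
    ext l
    simp only [mem_ofPred_eq, mem_Ioi, mem_homothet]
    refine ⟨fun ⟨h0, h⟩ => ⟨h0.lt_of_ne ?_, h⟩, fun ⟨h0, h⟩ => ⟨h0.le, h⟩⟩
    rintro rfl
    obtain ⟨c, -, hc⟩ := h
    exact hxy (sub_eq_zero.1 (by simpa using hc.symm))

theorem convexDist_self (hC : IsConvexBody C) (x : Plane) : convexDist C x x = 0 := by
  rw [hC.convexDist_eq_gauge, sub_self, gauge_zero]

theorem convexDist_pos (hC : IsConvexBody C) {x y : Plane} (h : x ≠ y) : 0 < convexDist C x y := by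
  rw [hC.convexDist_eq_gauge]
  exact hC.gauge_pos (sub_ne_zero.2 h.symm)

theorem convexDist_triangle (hC : IsConvexBody C) (x y z : Plane) :
    convexDist C x z ≤ convexDist C x y + convexDist C y z := by
  simp only [hC.convexDist_eq_gauge]
  simpa [add_comm] using hC.gauge_add_le (y - x) (z - y)

theorem continuous_convexDist (hC : IsConvexBody C) (y : Plane) :
    Continuous fun x => convexDist C x y := by
  simp only [hC.convexDist_eq_gauge]
  exact hC.continuous_gauge.comp (by fun_prop)

theorem convexDist_homothety_add (hC : IsConvexBody C) (p x : Plane) {t : ℝ} (h0 : 0 ≤ t)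
    (h1 : t ≤ 1) :
    convexDist C x (AffineMap.homothety p t x) + convexDist C (AffineMap.homothety p t x) p =
      convexDist C x p := by
  simp only [hC.convexDist_eq_gauge, AffineMap.homothety_apply, vsub_eq_sub, vadd_eq_add]
  have e1 : t • (x - p) + p - x = (1 - t) • (p - x) := by module
  have e2 : p - (t • (x - p) + p) = t • (p - x) := by module
  rw [e1, e2, gauge_smul_of_nonneg h0, gauge_smul_of_nonneg (sub_nonneg.2 h1)]
  simp only [smul_eq_mul]
  ring

theorem isClosed_nearestRegion (hC : IsConvexBody C) (S : Finset Plane) (p : Plane) :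
    IsClosed (nearestRegion C S p) := by
  have : nearestRegion C S p = ⋂ q ∈ S, {x | convexDist C x p ≤ convexDist C x q} := by
    ext; simp [nearestRegion]
  rw [this]
  exact isClosed_biInter fun q _ =>
    isClosed_le (hC.continuous_convexDist p) (hC.continuous_convexDist q)

theorem homothety_mem_nearestRegion (hC : IsConvexBody C) {p x : Plane} {t : ℝ} (h0 : 0 ≤ t)
    (h1 : t ≤ 1) (hx : x ∈ nearestRegion C S p) :
    AffineMap.homothety p t x ∈ nearestRegion C S p := fun q hq => by
  linarith [hC.convexDist_homothety_add p x h0 h1, hx q hq,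
    hC.convexDist_triangle x (AffineMap.homothety p t x) q]

/-- If a point between `x` and a nearest point `p` of `x` also has `q` as a nearest point, then
so does `x`. -/
theorem mem_nearestRegion_of_homothety (hC : IsConvexBody C) {p q x : Plane} (hp : p ∈ S) {t : ℝ}
    (h0 : 0 ≤ t) (h1 : t ≤ 1) (hx : x ∈ nearestRegion C S p)
    (hq : AffineMap.homothety p t x ∈ nearestRegion C S q) : x ∈ nearestRegion C S q :=
  fun r hr => by
    linarith [hC.convexDist_homothety_add p x h0 h1, hx r hr, hq p hp,
      hC.convexDist_triangle x (AffineMap.homothety p t x) q]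

end IsConvexBody

/-! ### Cells and tie-breaking. -/

/-- The open set whose closure is the Voronoi cell of `p`. -/
def cellInterior (C : Set Plane) (S : Finset Plane) (p : Plane) : Set Plane :=
  interior (nearestRegion C S p \ ⋃ q : {q : Plane // q ∈ S ∧ LexLT q p}, voronoiCell C S q.1)

variable {C : Set Plane} {S : Finset Plane}

theorem voronoiCell_eq_closure (C : Set Plane) (S : Finset Plane) (p : Plane) :
    voronoiCell C S p = closure (cellInterior C S p) := by
  rw [voronoiCell, cellInterior]

theorem isOpen_cellInterior (C : Set Plane) (S : Finset Plane) (p : Plane) :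
    IsOpen (cellInterior C S p) := isOpen_interior

theorem cellInterior_subset_nearestRegion (C : Set Plane) (S : Finset Plane) (p : Plane) :
    cellInterior C S p ⊆ nearestRegion C S p := fun _ hx => (interior_subset hx).1

theorem disjoint_cellInterior_voronoiCell_of_lexLT {p q : Plane} (hq : q ∈ S) (hqp : LexLT q p) :
    Disjoint (cellInterior C S p) (voronoiCell C S q) :=
  disjoint_left.2 fun _ hx hx' => (interior_subset hx).2 (mem_iUnion.2 ⟨⟨q, hq, hqp⟩, hx'⟩)

theorem subset_cellInterior {p : Plane} {W : Set Plane} (hW : IsOpen W)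
    (hn : W ⊆ nearestRegion C S p)
    (hd : ∀ q ∈ S, LexLT q p → Disjoint W (voronoiCell C S q)) : W ⊆ cellInterior C S p := by
  refine interior_maximal (fun x hx => ⟨hn hx, fun h => ?_⟩) hW
  obtain ⟨⟨q, hq, hqp⟩, hxq⟩ := mem_iUnion.1 h
  exact disjoint_left.1 (hd q hq hqp) hx hxq

theorem lexLT_or_lexLT {p q : Plane} (h : p ≠ q) : LexLT p q ∨ LexLT q p := by
  unfold LexLT
  rcases lt_trichotomy (p 0) (q 0) with h0 | h0 | h0
  · exact Or.inl (Or.inl h0)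
  · rcases lt_trichotomy (p 1) (q 1) with h1 | h1 | h1
    · exact Or.inl (Or.inr ⟨h0, h1⟩)
    · refine absurd ?_ h
      ext i
      fin_cases i <;> assumption
    · exact Or.inr (Or.inr ⟨h0.symm, h1⟩)
  · exact Or.inr (Or.inl h0)

/-- The construction only removes earlier cells from later ones. The other direction follows because
an open set that misses a set also misses its closure. -/
theorem disjoint_cellInterior_voronoiCell {p q : Plane} (hp : p ∈ S) (hq : q ∈ S) (h : p ≠ q) :
    Disjoint (cellInterior C S p) (voronoiCell C S q) := by
  rcases lexLT_or_lexLT h with h | h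
  · rw [voronoiCell_eq_closure]
    refine Disjoint.closure_right ?_ (isOpen_cellInterior C S p)
    exact ((disjoint_cellInterior_voronoiCell_of_lexLT hp h).mono_right
      ((voronoiCell_eq_closure C S p).symm ▸ subset_closure)).symm
  · exact disjoint_cellInterior_voronoiCell_of_lexLT hq h

/-- Ties are resolved in favour of the lexicographically smaller point. -/
theorem not_subset_nearestRegion_of_lexLT {p q : Plane} (hq : q ∈ S) (hqp : LexLT q p)
    {W : Set Plane} (hW : IsOpen W) (hne : W.Nonempty) (hWp : W ⊆ cellInterior C S p) :
    ¬ W ⊆ nearestRegion C S q := fun h => by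
  have hd : ∀ r ∈ S, LexLT r p → Disjoint W (voronoiCell C S r) := fun r hr hrp =>
    (disjoint_cellInterior_voronoiCell_of_lexLT hr hrp).mono_left hWp
  obtain ⟨x, hx⟩ := hne
  refine disjoint_left.1 (hd q hq hqp) hx ?_
  rw [voronoiCell_eq_closure]
  -- Cells preceding `q` also precede `p`, so `W` misses them all and would have been assigned to
  -- `q`.
  exact subset_closure (subset_cellInterior hW h (fun r hr hrq => hd r hr (hrq.trans hqp)) hx)

/-! ### Star-shapedness of the cells. -/

namespace IsConvexBody

theorem voronoiCell_subset_nearestRegion (hC : IsConvexBody C) (S : Finset Plane) (p : Plane) :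
    voronoiCell C S p ⊆ nearestRegion C S p := by
  rw [voronoiCell_eq_closure]
  exact closure_minimal (cellInterior_subset_nearestRegion C S p) (hC.isClosed_nearestRegion S p)

theorem self_mem_cellInterior (hC : IsConvexBody C) {p : Plane} (hp : p ∈ S) :
    p ∈ cellInterior C S p := by
  have hW : IsOpen (⋂ q ∈ S.erase p, {x | convexDist C x p < convexDist C x q}) :=
    isOpen_biInter_finset fun q _ =>
      isOpen_lt (hC.continuous_convexDist p) (hC.continuous_convexDist q)
  refine subset_cellInterior hW ?_ ?_ ?_
  · intro x hx q hq
    by_cases h : q = p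
    · rw [h]
    · simp only [mem_iInter] at hx
      exact (hx q (Finset.mem_erase.2 ⟨h, hq⟩)).le
  · refine fun q hq hqp => disjoint_left.2 fun x hx hxq => ?_
    have h : q ≠ p := by rintro rfl; exact LexLT.irrefl _ hqp
    simp only [mem_iInter] at hx
    exact (hx q (Finset.mem_erase.2 ⟨h, hq⟩)).not_ge
      (hC.voronoiCell_subset_nearestRegion S q hxq p hp)
  · simp only [mem_iInter]
    intro q hq
    rw [mem_ofPred_eq, hC.convexDist_self]
    exact hC.convexDist_pos (Finset.ne_of_mem_erase hq).symm

/-- Shrinking towards `p` keeps `p` nearest. If the shrunken set met an earlier cell, `q` would be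
nearest on an open part of it, hence also on the preimage of that part by
`mem_nearestRegion_of_homothety`; but there the tie should have gone to `q`. -/
theorem homothety_mem_cellInterior (hC : IsConvexBody C) {p x : Plane} (hp : p ∈ S) {t : ℝ}
    (h0 : 0 < t) (h1 : t ≤ 1) (hx : x ∈ cellInterior C S p) :
    AffineMap.homothety p t x ∈ cellInterior C S p := by
  have hopen := isOpen_cellInterior C S p
  refine subset_cellInterior (AffineMap.homothety_isOpenMap p t h0.ne' _ hopen) ?_ ?_
    (mem_image_of_mem _ hx)
  · rintro _ ⟨y, hy, rfl⟩
    exact hC.homothety_mem_nearestRegion h0.le h1 (cellInterior_subset_nearestRegion C S p hy)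
  · intro q hq hqp
    rw [voronoiCell_eq_closure]
    refine Disjoint.closure_right ?_ (AffineMap.homothety_isOpenMap p t h0.ne' _ hopen)
    rw [disjoint_left]
    rintro _ ⟨y, hy, rfl⟩ hyq
    refine not_subset_nearestRegion_of_lexLT (W := cellInterior C S p ∩
      AffineMap.homothety p t ⁻¹' cellInterior C S q) hq hqp
      (hopen.inter ((isOpen_cellInterior C S q).preimage (AffineMap.homothety_continuous p t)))
      ⟨y, hy, hyq⟩ inter_subset_left ?_
    rintro w ⟨hw, hwq⟩
    exact hC.mem_nearestRegion_of_homothety hp h0.le h1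
      (cellInterior_subset_nearestRegion C S p hw) (cellInterior_subset_nearestRegion C S q hwq)

theorem starConvex_cellInterior (hC : IsConvexBody C) {p : Plane} (hp : p ∈ S) :
    StarConvex ℝ p (cellInterior C S p) := by
  intro x hx a b ha hb hab
  rcases hb.eq_or_lt with rfl | hb
  · simpa [show a = 1 by linarith] using hC.self_mem_cellInterior hp
  · have := hC.homothety_mem_cellInterior hp hb (by linarith) hx
    rwa [AffineMap.homothety_apply, vsub_eq_sub, vadd_eq_add,
      show b • (x - p) + p = a • p + b • x by
        rw [show a = 1 - b by linarith]; module] at this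

theorem starConvex_voronoiCell (hC : IsConvexBody C) {p : Plane} (hp : p ∈ S) :
    StarConvex ℝ p (voronoiCell C S p) := by
  rw [voronoiCell_eq_closure]
  intro x hx a b ha hb hab
  exact map_mem_closure (f := fun y => a • p + b • y) (by fun_prop) hx
    fun y hy => hC.starConvex_cellInterior hp hy ha hb hab

end IsConvexBody

/-! ### Planar linear algebra and segments. -/

/-- The oriented area of the parallelogram spanned by two vectors of the plane. -/
def area (u v : Plane) : ℝ := u 0 * v 1 - u 1 * v 0

theorem continuous_area_left (v : Plane) : Continuous fun u => area u v := by
  unfold area; fun_prop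

theorem continuous_area_right (u : Plane) : Continuous fun v => area u v := by
  unfold area; fun_prop

/-- Cramer's rule; the explicit coefficients are used later for their continuity in `w`. -/
theorem eq_smul_add_smul_of_area_ne_zero {u v : Plane} (h : area u v ≠ 0) (w : Plane) :
    w = (area w v / area u v) • u + (area u w / area u v) • v := by
  ext i
  fin_cases i <;> simp <;> field_simp <;> simp only [area] <;> ring

theorem exists_smul_eq_of_area_eq_zero {u v : Plane} (h : area u v = 0) (hu : u ≠ 0) :
    ∃ c : ℝ, v = c • u := by
  simp only [area] at h
  by_cases h0 : u 0 = 0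
  · have h1 : u 1 ≠ 0 := fun h1 => hu (by ext i; fin_cases i <;> assumption)
    refine ⟨v 1 / u 1, ?_⟩
    ext i
    fin_cases i <;> simp <;> field_simp
    simp_all
  · refine ⟨v 0 / u 0, ?_⟩
    ext i
    fin_cases i <;> simp <;> field_simp
    linarith

section Segments

variable {E : Type*} [AddCommGroup E] [Module ℝ E]

theorem add_smul_mem_segment (u e : E) {a b c : ℝ} (h1 : a ≤ b) (h2 : b ≤ c) :
    u + b • e ∈ segment ℝ (u + a • e) (u + c • e) := by
  rcases h1.eq_or_lt with rfl | h1
  · exact left_mem_segment ℝ _ _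
  · have hca : c - a ≠ 0 := by linarith
    refine ⟨(c - b) / (c - a), (b - a) / (c - a), div_nonneg (by linarith) (by linarith),
      div_nonneg (by linarith) (by linarith), by field_simp; ring, ?_⟩
    have e1 : (c - b) / (c - a) = 1 - (b - a) / (c - a) := by field_simp; ring
    have e2 : b = a + (b - a) / (c - a) * (c - a) := by field_simp; ring
    rw [e1]
    conv_rhs => rw [e2]
    module

/-- If two open segments of a line meet, then an endpoint of one lies in the other. -/
theorem endpoint_mem_of_openSegments_meet {a b c d u : E} {k : ℝ} (hk : d - c = k • (b - a))
    (hu : u ∈ openSegment ℝ a b) (hu' : u ∈ openSegment ℝ c d) :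
    b ∈ segment ℝ c d ∨ d ∈ segment ℝ a b ∨ c ∈ segment ℝ a b := by
  obtain ⟨s, t, hs, ht, hst, rfl⟩ := hu
  obtain ⟨σ, τ, hσ, hτ, hστ, he⟩ := hu'
  obtain rfl : s = 1 - t := by linarith
  obtain rfl : σ = 1 - τ := by linarith
  set u := (1 - t) • a + t • b with hu
  have ea : a = u + (-t) • (b - a) := by rw [hu]; module
  have eb : b = u + (1 - t) • (b - a) := by rw [hu]; module
  have ec : c = u + (-τ * k) • (b - a) := by rw [mul_smul, ← hk, ← he]; module
  have ed : d = u + ((1 - τ) * k) • (b - a) := by rw [mul_smul, ← hk, ← he]; module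
  set e := b - a
  clear_value u e
  subst ea eb ec ed
  -- With the common point as origin, the sign of `k` tells which endpoint of the second segment is
  -- on the same side as `b`; of these two, the one nearer to the origin lies in the other segment.
  rcases le_total 0 k with h0 | h0
  · rcases le_total (1 - t) ((1 - τ) * k) with h | h
    · exact Or.inl (add_smul_mem_segment u e (by nlinarith) h)
    · exact Or.inr (Or.inl (add_smul_mem_segment u e (by nlinarith) h))
  · rcases le_total (1 - t) (-τ * k) with h | h
    · left
      rw [segment_symm]
      exact add_smul_mem_segment u e (by nlinarith) h
    · exact Or.inr (Or.inr (add_smul_mem_segment u e (by nlinarith) h))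

theorem mem_openSegment_of_mem_segment {a b z : E} (h : z ∈ segment ℝ a b) (ha : z ≠ a)
    (hb : z ≠ b) : z ∈ openSegment ℝ a b := mem_openSegment_of_ne_left_right ha.symm hb.symm h

end Segments

/-! ### Crossing polylines. -/

/-- The polylines from `(1, 0)` over `(x₁, x₂)` to `(-b, 0)` and from `(0, 1)` over `(y₁, y₂)` to
`(0, -d)` meet, unless one of the starting points lies in the triangle spanned by the other
polyline. -/
theorem polylines_meet_of_coords {b d x₁ x₂ y₁ y₂ : ℝ} (hb : 0 < b) (hd : 0 < d) (hx : 0 ≤ x₂)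
    (hy : 0 ≤ y₁) (hA : ¬ (1 ≤ x₁ + x₂ ∧ x₁ + b ≤ b * x₂))
    (hB : ¬ (1 ≤ y₁ + y₂ ∧ y₂ + d ≤ d * y₁)) :
    ∃ u : ℝ × ℝ,
      (u ∈ segment ℝ ((1, 0) : ℝ × ℝ) (x₁, x₂) ∨ u ∈ segment ℝ ((-b, 0) : ℝ × ℝ) (x₁, x₂)) ∧
      (u ∈ segment ℝ ((0, 1) : ℝ × ℝ) (y₁, y₂) ∨ u ∈ segment ℝ ((0, -d) : ℝ × ℝ) (y₁, y₂)) := by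
  -- the point `(0, h)` where the first polyline crosses the second coordinate axis
  obtain ⟨h, hh0, hh1, hh⟩ : ∃ h : ℝ, 0 ≤ h ∧ h < 1 ∧
      ((((0, h) : ℝ × ℝ) ∈ segment ℝ ((1, 0) : ℝ × ℝ) (x₁, x₂)) ∨
        0 ≤ x₁ ∧ ((0, h) : ℝ × ℝ) ∈ segment ℝ ((-b, 0) : ℝ × ℝ) (x₁, x₂)) := by
    rcases le_total 0 x₁ with h0 | h0
    · have hpos : 0 < x₁ + b := by linarith
      refine ⟨b * x₂ / (x₁ + b), by positivity, ?_, Or.inr ⟨h0, x₁ / (x₁ + b), b / (x₁ + b),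
        by positivity, by positivity, by field_simp, ?_⟩⟩
      · rw [div_lt_one hpos]
        by_contra! hc
        exact hA ⟨by nlinarith, hc⟩
      · ext
        · simp; field_simp; ring
        · simp; field_simp
    · have hpos : 0 < 1 - x₁ := by linarith
      refine ⟨x₂ / (1 - x₁), by positivity, ?_, Or.inl ⟨-x₁ / (1 - x₁), 1 / (1 - x₁),
        div_nonneg (by linarith) hpos.le, by positivity, by field_simp; ring, ?_⟩⟩
      · rw [div_lt_one hpos]
        by_contra! hc
        exact hA ⟨by linarith, by nlinarith⟩
      · ext
        · simp; field_simp; ring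
        · simp; field_simp
  -- If `y₁ = 0`, the second polyline runs inside the axis and covers everything from `-d` to `1`,
  -- in particular `(0, h)`.
  rcases hy.eq_or_lt with rfl | hy
  · refine ⟨(0, h), hh.imp_right And.right, ?_⟩
    have key (a c e : ℝ) (h1 : a ≤ c) (h2 : c ≤ e) :
        ((0, c) : ℝ × ℝ) ∈ segment ℝ ((0, a) : ℝ × ℝ) (0, e) := by
      simpa using add_smul_mem_segment ((0, 0) : ℝ × ℝ) ((0, 1) : ℝ × ℝ) h1 h2
    rcases le_total h y₂ with hy | hy
    · exact Or.inr (key _ _ _ (by linarith) hy)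
    · left
      rw [segment_symm]
      exact key _ _ _ hy hh1.le
  -- the boundary equations of the triangle spanned by the second polyline
  let f₁ : ℝ × ℝ → ℝ := fun u => y₁ * (1 - u.2) + u.1 * (y₂ - 1)
  let f₂ : ℝ × ℝ → ℝ := fun u => y₁ * (u.2 + d) - u.1 * (y₂ + d)
  have hsum (u : ℝ × ℝ) : f₁ u + f₂ u = (1 + d) * (y₁ - u.1) := by simp only [f₁, f₂]; ring
  have zero (u : ℝ × ℝ) (hu : 0 ≤ u.1) (h0 : min (f₁ u) (f₂ u) = 0) :
      (u ∈ segment ℝ ((0, 1) : ℝ × ℝ) (y₁, y₂) ∨ u ∈ segment ℝ ((0, -d) : ℝ × ℝ) (y₁, y₂)) := by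
    have hle : u.1 ≤ y₁ := by
      have h1 : 0 ≤ f₁ u := h0 ▸ min_le_left _ _
      have h2 : 0 ≤ f₂ u := h0 ▸ min_le_right _ _
      nlinarith [hsum u]
    have hs : ∀ a : ℝ, y₁ * (u.2 - a) = u.1 * (y₂ - a) →
        u ∈ segment ℝ ((0, a) : ℝ × ℝ) (y₁, y₂) := fun a ha => by
      refine ⟨(y₁ - u.1) / y₁, u.1 / y₁, div_nonneg (by linarith) hy.le, by positivity,
        by field_simp; ring, ?_⟩
      ext
      · simp; field_simp
      · simp; field_simp; linarith
    rcases min_choice (f₁ u) (f₂ u) with hm | hm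
    · exact Or.inl (hs 1 (by have := hm.symm.trans h0; simp only [f₁] at this; linarith))
    · exact Or.inr (hs (-d) (by have := hm.symm.trans h0; simp only [f₂] at this; linarith))
  have hcont : Continuous fun u => min (f₁ u) (f₂ u) := by fun_prop
  have ivt (v w : ℝ × ℝ) (hv1 : 0 ≤ v.1) (hw1 : 0 ≤ w.1) (hv : min (f₁ v) (f₂ v) ≤ 0)
      (hw : 0 ≤ min (f₁ w) (f₂ w)) : ∃ u ∈ segment ℝ v w,
      (u ∈ segment ℝ ((0, 1) : ℝ × ℝ) (y₁, y₂) ∨ u ∈ segment ℝ ((0, -d) : ℝ × ℝ) (y₁, y₂)) := by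
    obtain ⟨u, hu, hu0⟩ := (convex_segment v w).isPreconnected.intermediate_value
      (left_mem_segment ℝ v w) (right_mem_segment ℝ v w) hcont.continuousOn ⟨hv, hw⟩
    refine ⟨u, hu, zero u ?_ hu0⟩
    obtain ⟨s, t, hs, ht, -, rfl⟩ := hu
    simp only [Prod.fst_add, Prod.smul_fst, smul_eq_mul]
    positivity
  have hp : min (f₁ (1, 0)) (f₂ (1, 0)) ≤ 0 := by
    by_contra! hc
    have h1 := lt_min_iff.1 hc
    simp only [f₁, f₂] at h1
    exact hB ⟨by linarith, by linarith⟩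
  have hw : 0 ≤ min (f₁ (0, h)) (f₂ (0, h)) := by
    refine le_min ?_ ?_ <;> simp only [f₁, f₂] <;> nlinarith
  -- Walk along the first polyline from `(1, 0)`, which is not strictly inside the second triangle,
  -- to `(0, h)`, which is in it. The walk stays in the half-plane `0 ≤ u.1`, where zeros of `min f₁
  -- f₂` lie on the second polyline; `ivt` is applied to the straight piece on which the sign
  -- changes.
  rcases hh with hh | ⟨hx1, hh⟩
  · obtain ⟨u, hu, hu'⟩ := ivt (1, 0) (0, h) zero_le_one le_rfl hp hw
    exact ⟨u, Or.inl ((convex_segment _ _).segment_subset (left_mem_segment ℝ _ _) hh hu), hu'⟩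
  · rcases le_total (min (f₁ (x₁, x₂)) (f₂ (x₁, x₂))) 0 with h0 | h0
    · obtain ⟨u, hu, hu'⟩ := ivt (x₁, x₂) (0, h) hx1 le_rfl h0 hw
      exact ⟨u, Or.inr ((convex_segment _ _).segment_subset (right_mem_segment ℝ _ _) hh hu), hu'⟩
    · obtain ⟨u, hu, hu'⟩ := ivt (1, 0) (x₁, x₂) zero_le_one hx1 hp h0
      exact ⟨u, Or.inl hu, hu'⟩

section Polylines

variable {E : Type*} [AddCommGroup E] [Module ℝ E]

/-- `w` is a convex combination of `p`, `q` and `x`. -/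
def MemTriangle (p q x w : E) : Prop :=
  ∃ α β γ : ℝ, 0 ≤ α ∧ 0 ≤ β ∧ 0 ≤ γ ∧ α + β + γ = 1 ∧ α • p + β • q + γ • x = w

theorem MemTriangle.swap {p q x w : E} (h : MemTriangle p q x w) : MemTriangle q p x w := by
  obtain ⟨α, β, γ, hα, hβ, hγ, hs, rfl⟩ := h
  exact ⟨β, α, γ, hβ, hα, hγ, by linarith, by rw [add_comm (β • q)]⟩

theorem memTriangle_of_coords {p q r x z : E} {b x₁ x₂ : ℝ} (hb : 0 < b)
    (hq : q = z + (-b) • (p - z)) (hx : x = z + (x₁ • (p - z) + x₂ • (r - z)))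
    (h1 : 1 ≤ x₁ + x₂) (h2 : x₁ + b ≤ b * x₂) : MemTriangle p q x r := by
  have hx2 : 0 < x₂ := by nlinarith
  have hα : (b * x₂ - b - x₁) / (x₂ * (1 + b)) = 1 - (x₂ - 1 + x₁) / (x₂ * (1 + b)) - 1 / x₂ := by
    field_simp; ring
  have hc : 1 - (x₂ - 1 + x₁) / (x₂ * (1 + b)) - 1 / x₂ =
      b * ((x₂ - 1 + x₁) / (x₂ * (1 + b))) - 1 / x₂ * x₁ := by
    field_simp; ring
  have hc' : 1 / x₂ * x₂ = 1 := by field_simp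
  refine ⟨(b * x₂ - b - x₁) / (x₂ * (1 + b)), (x₂ - 1 + x₁) / (x₂ * (1 + b)), 1 / x₂,
    div_nonneg (by linarith) (by positivity), div_nonneg (by linarith) (by positivity),
    by positivity, by rw [hα]; ring, ?_⟩
  rw [hα, hq, hx]
  generalize (x₂ - 1 + x₁) / (x₂ * (1 + b)) = β at *
  generalize 1 / x₂ = γ at *
  calc _ = z + (1 - β - γ - b * β + γ * x₁) • (p - z) + (γ * x₂) • (r - z) := by module
    _ = r := by rw [hc', hc]; module

theorem polylines_meet_of_nonneg {p q r s x y z : E} {b d x₁ x₂ y₁ y₂ : ℝ} (hb : 0 < b)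
    (hd : 0 < d) (hq : q = z + (-b) • (p - z)) (hs : s = z + (-d) • (r - z))
    (hx : x = z + (x₁ • (p - z) + x₂ • (r - z))) (hy : y = z + (y₁ • (p - z) + y₂ • (r - z)))
    (hx2 : 0 ≤ x₂) (hy1 : 0 ≤ y₁) (hA : ¬ MemTriangle p q x r) (hB : ¬ MemTriangle r s y p) :
    ∃ u, (u ∈ segment ℝ p x ∨ u ∈ segment ℝ q x) ∧ (u ∈ segment ℝ r y ∨ u ∈ segment ℝ s y) := by
  obtain ⟨u, hu, hu'⟩ := polylines_meet_of_coords hb hd hx2 hy1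
    (fun h => hA (memTriangle_of_coords hb hq hx h.1 h.2))
    (fun h => hB (memTriangle_of_coords hd hs (hy.trans (by rw [add_comm (y₁ • _)]))
      (by linarith) h.2))
  have map {a c : ℝ × ℝ} (h : u ∈ segment ℝ a c) : z + (u.1 • (p - z) + u.2 • (r - z)) ∈
      segment ℝ (z + (a.1 • (p - z) + a.2 • (r - z))) (z + (c.1 • (p - z) + c.2 • (r - z))) := by
    obtain ⟨σ, τ, hσ, hτ, hστ, rfl⟩ := h
    refine ⟨σ, τ, hσ, hτ, hστ, ?_⟩
    obtain rfl : σ = 1 - τ := by linarith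
    simp only [Prod.fst_add, Prod.smul_fst, Prod.snd_add, Prod.smul_snd, smul_eq_mul]
    module
  have ep : z + ((1 : ℝ) • (p - z) + (0 : ℝ) • (r - z)) = p := by module
  have eq : z + ((-b : ℝ) • (p - z) + (0 : ℝ) • (r - z)) = q := by rw [hq]; module
  have er : z + ((0 : ℝ) • (p - z) + (1 : ℝ) • (r - z)) = r := by module
  have es : z + ((0 : ℝ) • (p - z) + (-d : ℝ) • (r - z)) = s := by rw [hs]; module
  refine ⟨z + (u.1 • (p - z) + u.2 • (r - z)), ?_, ?_⟩
  · exact hu.imp (fun h => by simpa only [ep, ← hx] using map h)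
      (fun h => by simpa only [eq, ← hx] using map h)
  · exact hu'.imp (fun h => by simpa only [er, ← hy] using map h)
      (fun h => by simpa only [es, ← hy] using map h)

end Polylines

theorem exists_neg_smul_of_mem_openSegment {p q z : Plane} (h : z ∈ openSegment ℝ p q) :
    ∃ b : ℝ, 0 < b ∧ q = z + (-b) • (p - z) ∧ p = z + (-b⁻¹) • (q - z) := by
  obtain ⟨s, t, hs, ht, hst, rfl⟩ := h
  have h1 : q - (s • p + t • q) = s • (q - p) := by
    obtain rfl : t = 1 - s := by linarith
    module
  have h2 : p - (s • p + t • q) = (-t) • (q - p) := by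
    obtain rfl : s = 1 - t := by linarith
    module
  refine ⟨s / t, by positivity, ?_, ?_⟩
  · rw [← sub_eq_iff_eq_add', h1, h2, smul_smul]
    congr 1
    field_simp
  · rw [← sub_eq_iff_eq_add', h1, h2, smul_smul]
    congr 1
    field_simp

/-- If two segments cross, then polylines with the same endpoints meet, unless an endpoint of one
lies in the triangle spanned by the other. -/
theorem polylines_meet {p q r s z : Plane} (x y : Plane) (hpq : z ∈ openSegment ℝ p q)
    (hrs : z ∈ openSegment ℝ r s) (hne : area (p - z) (r - z) ≠ 0)
    (hr : ¬ MemTriangle p q x r) (hs : ¬ MemTriangle p q x s)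
    (hp : ¬ MemTriangle r s y p) (hq : ¬ MemTriangle r s y q) :
    ∃ u, (u ∈ segment ℝ p x ∨ u ∈ segment ℝ q x) ∧ (u ∈ segment ℝ r y ∨ u ∈ segment ℝ s y) := by
  obtain ⟨b, hb, eq, ep⟩ := exists_neg_smul_of_mem_openSegment hpq
  obtain ⟨d, hd, es, er⟩ := exists_neg_smul_of_mem_openSegment hrs
  have coords (w : Plane) : ∃ w₁ w₂ : ℝ, w = z + (w₁ • (p - z) + w₂ • (r - z)) :=
    ⟨_, _, sub_eq_iff_eq_add'.1 (eq_smul_add_smul_of_area_ne_zero hne (w - z))⟩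
  obtain ⟨x₁, x₂, hx⟩ := coords x
  obtain ⟨y₁, y₂, hy⟩ := coords y
  have hpz (a : ℝ) : a • (p - z) = (-b⁻¹ * a) • (q - z) := by
    conv_lhs => rw [ep]
    module
  have hrz (a : ℝ) : a • (r - z) = (-d⁻¹ * a) • (s - z) := by
    conv_lhs => rw [er]
    module
  have neg (c a : ℝ) (hc : 0 < c) (ha : a ≤ 0) : 0 ≤ -c⁻¹ * a := by
    have := inv_pos.2 hc
    nlinarith
  -- Exchanging `p` with `q`, or `r` with `s`, flips the sign of one coordinate, so both may be
  -- taken nonnegative.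
  rcases le_total 0 x₂ with hx2 | hx2 <;> rcases le_total 0 y₁ with hy1 | hy1
  · exact polylines_meet_of_nonneg hb hd eq es hx hy hx2 hy1 hr hp
  · rw [hpz] at hx hy
    obtain ⟨u, hu, hu'⟩ := polylines_meet_of_nonneg (inv_pos.2 hb) hd ep es hx hy hx2
      (neg b y₁ hb hy1) (mt MemTriangle.swap hr) hq
    exact ⟨u, hu.symm, hu'⟩
  · rw [hrz] at hx hy
    obtain ⟨u, hu, hu'⟩ := polylines_meet_of_nonneg hb (inv_pos.2 hd) eq er hx hy
      (neg d x₂ hd hx2) hy1 hs (mt MemTriangle.swap hp)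
    exact ⟨u, hu, hu'.symm⟩
  · rw [hpz, hrz] at hx hy
    obtain ⟨u, hu, hu'⟩ := polylines_meet_of_nonneg (inv_pos.2 hb) (inv_pos.2 hd) ep er hx hy
      (neg d x₂ hd hx2) (neg b y₁ hb hy1) (mt MemTriangle.swap hs) (mt MemTriangle.swap hq)
    exact ⟨u, hu.symm, hu'.symm⟩

/-! ### Sites, witnesses and crossing edges. -/

namespace IsConvexBody

/-- Hahn–Banach: a supporting functional of the gauge in direction `w`. -/
theorem exists_le_gauge (hC : IsConvexBody C) (w : Plane) :
    ∃ L : Plane →ₗ[ℝ] ℝ, (∀ u, L u ≤ gauge C u) ∧ L w = gauge C w := by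
  by_cases hw : w = 0
  · exact ⟨0, fun u => gauge_nonneg u, by simp [hw]⟩
  obtain ⟨L, hL, hle⟩ := exists_extension_of_le_sublinear
    (LinearPMap.mkSpanSingleton (σ := RingHom.id ℝ) w (gauge C w) hw) (gauge C)
    (fun c hc u => by rw [gauge_smul_of_nonneg hc.le, smul_eq_mul]) hC.gauge_add_le (by
      rintro ⟨u, hu⟩
      obtain ⟨c, rfl⟩ := Submodule.mem_span_singleton.1 hu
      rw [LinearPMap.mkSpanSingleton'_apply]
      rcases le_total 0 c with hc | hc
      · simp [gauge_smul_of_nonneg hc]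
      · exact (mul_nonpos_of_nonpos_of_nonneg hc (gauge_nonneg _)).trans (gauge_nonneg _))
  refine ⟨L, hle, ?_⟩
  have := hL ⟨w, Submodule.mem_span_singleton_self w⟩
  simpa using this.trans (LinearPMap.mkSpanSingleton_apply ℝ ℝ hw _)

theorem convexDist_eq_of_mem (hC : IsConvexBody C) {p q x : Plane} (hp : p ∈ S) (hq : q ∈ S)
    (hxp : x ∈ voronoiCell C S p) (hxq : x ∈ voronoiCell C S q) :
    convexDist C x p = convexDist C x q :=
  le_antisymm (hC.voronoiCell_subset_nearestRegion S p hxp q hq)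
    (hC.voronoiCell_subset_nearestRegion S q hxq p hp)

theorem convexDist_pos_of_mem (hC : IsConvexBody C) {p q x : Plane} (hp : p ∈ S) (hq : q ∈ S)
    (hne : p ≠ q) (hxp : x ∈ voronoiCell C S p) (hxq : x ∈ voronoiCell C S q) :
    0 < convexDist C x p := by
  by_cases h : x = p
  · rw [hC.convexDist_eq_of_mem hp hq hxp hxq]
    exact hC.convexDist_pos (h ▸ hne)
  · exact hC.convexDist_pos h

/-- If `v` were between `p` and `q`, the segment would lie in the boundary of the homothet of `C`
about `x` through `p` and `q`, so the gauge would be linear on the cone spanned by `p - x` and `q -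
x`. Then near `x` the site `v` is no farther than `q`, and being lexicographically smaller it takes
that part of the cell of `q`. -/
theorem not_mem_openSegment_of_lexLT (hC : IsConvexBody C) {p q v x : Plane} (hp : p ∈ S)
    (hq : q ∈ S) (hv : v ∈ S) (hne : p ≠ q) (hvq : LexLT v q) (hxp : x ∈ voronoiCell C S p)
    (hxq : x ∈ voronoiCell C S q) : v ∉ openSegment ℝ p q := by
  rintro ⟨θ, η, hθ, hη, hθη, hv'⟩
  have heq := hC.convexDist_eq_of_mem hp hq hxp hxq
  have hpos := hC.convexDist_pos_of_mem hp hq hne hxp hxq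
  have hle := hC.voronoiCell_subset_nearestRegion S p hxp v hv
  simp only [hC.convexDist_eq_gauge] at heq hpos hle
  obtain ⟨L, hL, hLv⟩ := hC.exists_le_gauge (v - x)
  have hvx : v - x = θ • (p - x) + η • (q - x) := by
    rw [← hv']
    obtain rfl : θ = 1 - η := by linarith
    module
  have hLvx : L (v - x) = θ * L (p - x) + η * L (q - x) := by
    rw [hvx, map_add, map_smul, map_smul, smul_eq_mul, smul_eq_mul]
  have hLp := hL (p - x)
  have hLq := hL (q - x)
  set l := gauge C (p - x)
  rw [← heq] at hLq
  -- Both values are at most `l`, while their weighted mean `L (v - x)` is at least `l`.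
  have hLp' : L (p - x) = l := by
    obtain rfl : θ = 1 - η := by linarith
    nlinarith
  have hLq' : L (q - x) = l := by
    obtain rfl : θ = 1 - η := by linarith
    nlinarith
  have harea : area (p - x) (q - x) ≠ 0 := fun h => by
    obtain ⟨k, hk⟩ := exists_smul_eq_of_area_eq_zero h fun h0 => by
      rw [h0, map_zero] at hLp'
      exact hpos.ne hLp'
    rw [hk, map_smul, hLp', smul_eq_mul] at hLq'
    obtain rfl : k = 1 := by
      refine mul_right_cancel₀ hpos.ne' (hLq'.trans (one_mul l).symm)
    rw [one_smul] at hk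
    exact hne (sub_left_injective hk).symm
  let α : Plane → ℝ := fun a => area (v - a) (q - x) / area (p - x) (q - x)
  let β : Plane → ℝ := fun a => area (p - x) (v - a) / area (p - x) (q - x)
  have hα : Continuous α :=
    ((continuous_area_left _).comp (continuous_const.sub continuous_id)).div_const _
  have hβ : Continuous β :=
    ((continuous_area_right _).comp (continuous_const.sub continuous_id)).div_const _
  have hαx : α x = θ := by
    simp only [α]
    rw [div_eq_iff harea, hvx]
    simp [area]
    ring
  have hβx : β x = η := by
    simp only [β]
    rw [div_eq_iff harea, hvx]
    simp [area]
    ring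
  -- The points from which `v` is seen in the open cone; this is a neighbourhood of `x`, so it meets
  -- the interior of the cell of `q`.
  have hopen : IsOpen {a | 0 < α a ∧ 0 < β a} :=
    (isOpen_lt continuous_const hα).inter (isOpen_lt continuous_const hβ)
  rw [voronoiCell_eq_closure C S q] at hxq
  refine not_subset_nearestRegion_of_lexLT hv hvq (hopen.inter (isOpen_cellInterior C S q))
    (mem_closure_iff.1 hxq _ hopen ⟨hαx ▸ hθ, hβx ▸ hη⟩) inter_subset_right ?_
  rintro a ⟨⟨ha, hb⟩, haq⟩ r hr
  refine le_trans ?_ (cellInterior_subset_nearestRegion C S q haq r hr)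
  rw [hC.convexDist_eq_gauge, hC.convexDist_eq_gauge]
  have hva : v - a = α a • (p - x) + β a • (q - x) := eq_smul_add_smul_of_area_ne_zero harea _
  calc gauge C (v - a) ≤ gauge C (α a • (p - x)) + gauge C (β a • (q - x)) := by
        rw [hva]; exact hC.gauge_add_le _ _
    _ = L (v - a) := by
        rw [gauge_smul_of_nonneg ha.le, gauge_smul_of_nonneg hb.le, ← heq, hva, map_add, map_smul,
          map_smul, hLp', hLq']
    _ = L (q - a) := by
        have e : q - a = (v - a) + ((q - x) - (v - x)) := by abel
        have e' : L ((q - x) - (v - x)) = 0 := by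
          rw [map_sub _ (q - x), hLvx, hLp', hLq', ← add_mul, hθη, one_mul, sub_self]
        rw [e, map_add, e', add_zero]
    _ ≤ gauge C (q - a) := hL _

/-- A point strictly between two others precedes the lexicographically larger of them. -/
theorem not_mem_openSegment (hC : IsConvexBody C) {p q v x : Plane} (hp : p ∈ S)
    (hq : q ∈ S) (hv : v ∈ S) (hne : p ≠ q) (hxp : x ∈ voronoiCell C S p)
    (hxq : x ∈ voronoiCell C S q) : v ∉ openSegment ℝ p q := by
  intro h
  have hlex : LexLT v q ∨ LexLT v p := by
    obtain ⟨θ, η, hθ, hη, hθη, rfl⟩ := h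
    obtain rfl : θ = 1 - η := by linarith
    rcases lexLT_or_lexLT hne with h | h
    · left
      rcases h with h | ⟨h, h'⟩
      · left; simp; nlinarith
      · right; simp [h]; constructor <;> nlinarith
    · right
      rcases h with h | ⟨h, h'⟩
      · left; simp; nlinarith
      · right; simp [h]; constructor <;> nlinarith
  rcases hlex with hlex | hlex
  · exact hC.not_mem_openSegment_of_lexLT hp hq hv hne hlex hxp hxq h
  · rw [openSegment_symm] at h
    exact hC.not_mem_openSegment_of_lexLT hq hp hv hne.symm hlex hxq hxp h

theorem self_notMem_voronoiCell (hC : IsConvexBody C) {p q : Plane} (hp : p ∈ S) (hq : q ∈ S)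
    (hne : p ≠ q) : p ∉ voronoiCell C S q :=
  disjoint_left.1 (disjoint_cellInterior_voronoiCell hp hq hne) (hC.self_mem_cellInterior hp)

/-- Segments joining two sites to points of their Voronoi cells are disjoint, provided that none
of these points lies in the cell of the other site. -/
theorem disjoint_segment (hC : IsConvexBody C) {p r x y : Plane} (hp : p ∈ S) (hr : r ∈ S)
    (hne : p ≠ r) (hxp : x ∈ voronoiCell C S p) (hxr : x ∉ voronoiCell C S r)
    (hyr : y ∈ voronoiCell C S r) (hyp : y ∉ voronoiCell C S p) :
    Disjoint (segment ℝ p x) (segment ℝ r y) := by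
  rw [disjoint_left]
  intro u hu hu'
  have hpx := (hC.starConvex_voronoiCell hp).segment_subset hxp
  have hry := (hC.starConvex_voronoiCell hr).segment_subset hyr
  replace hu : u ∈ openSegment ℝ p x := mem_openSegment_of_mem_segment hu
    (fun h => hC.self_notMem_voronoiCell hp hr hne (h ▸ hry hu')) (fun h => hxr (h ▸ hry hu'))
  replace hu' : u ∈ openSegment ℝ r y := mem_openSegment_of_mem_segment hu'
    (fun h => hC.self_notMem_voronoiCell hr hp hne.symm
      (h ▸ hpx (openSegment_subset_segment _ _ _ hu)))
    (fun h => hyp (h ▸ hpx (openSegment_subset_segment _ _ _ hu)))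
  by_cases hD : area (x - p) (y - r) = 0
  · obtain ⟨k, hk⟩ := exists_smul_eq_of_area_eq_zero hD (sub_ne_zero.2 fun h => by
      subst h
      rw [openSegment_same, mem_singleton_iff] at hu
      exact hxr (hry (openSegment_subset_segment _ _ _ (hu ▸ hu'))))
    rcases endpoint_mem_of_openSegments_meet hk hu hu' with h | h | h
    · exact hxr (hry h)
    · exact hyp (hpx h)
    · exact hC.self_notMem_voronoiCell hr hp hne.symm (hpx h)
  obtain ⟨s, t, hs, ht, hst, hut⟩ := hu
  obtain ⟨σ, τ, hσ, hτ, hστ, huτ⟩ := hu'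
  let α : Plane → ℝ := fun a => area (a - x) (y - r) / area (x - p) (y - r)
  let β : Plane → ℝ := fun a => area (x - p) (a - x) / area (x - p) (y - r)
  have hα : Continuous α :=
    ((continuous_area_left _).comp (continuous_id.sub continuous_const)).div_const _
  have hβ : Continuous β :=
    ((continuous_area_right _).comp (continuous_id.sub continuous_const)).div_const _
  have hαx : α x = 0 := by simp [α, area]
  have hβx : β x = 0 := by simp [β, area]
  -- `x` may be a boundary point, so it is replaced by a nearby interior point `a` whose segment to
  -- `p` still crosses the segment from `r` to `y`. The three bounds give `ρ ≤ 1` and keep the new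
  -- crossing point between `r` and `y`.
  have hopen : IsOpen {a | (t - 1 < α a ∧ -τ < β a) ∧ β a < 1 - τ} :=
    ((isOpen_lt continuous_const hα).inter (isOpen_lt continuous_const hβ)).inter
      (isOpen_lt hβ continuous_const)
  rw [voronoiCell_eq_closure C S p] at hxp
  obtain ⟨a, ⟨⟨h1, h2⟩, h3⟩, ha⟩ := mem_closure_iff.1 hxp _ hopen
    ⟨⟨by rw [hαx]; linarith, by rw [hβx]; linarith⟩, by rw [hβx]; linarith⟩
  have hax : a - x = α a • (x - p) + β a • (y - r) := eq_smul_add_smul_of_area_ne_zero hD _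
  generalize α a = α₀ at *
  generalize β a = β₀ at *
  have h4 : 0 < 1 + α₀ := by linarith
  -- This makes the component of `ρ • (a - p)` along `x - p` equal to that of `u - p`, so the new
  -- point differs from `u` only in the direction `y - r`.
  set ρ := t / (1 + α₀) with hρ
  have hρ0 : 0 < ρ := by positivity
  have hρ1 : ρ ≤ 1 := by rw [hρ, div_le_one h4]; linarith
  have hρt : ρ * (1 + α₀) = t := by rw [hρ]; field_simp
  refine disjoint_left.1 (disjoint_cellInterior_voronoiCell hp hr hne)
    ((hC.starConvex_cellInterior hp).add_smul_sub_mem ha hρ0.le hρ1) ?_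
  have e : p + ρ • (a - p) = r + (τ + ρ * β₀) • (y - r) := by
    have e1 : a = x + (α₀ • (x - p) + β₀ • (y - r)) := sub_eq_iff_eq_add'.1 hax
    obtain rfl : s = 1 - t := by linarith
    obtain rfl : σ = 1 - τ := by linarith
    calc p + ρ • (a - p) = p + (ρ * (1 + α₀)) • (x - p) + (ρ * β₀) • (y - r) := by
          rw [e1]; module
      _ = ((1 - t) • p + t • x) + (ρ * β₀) • (y - r) := by rw [hρt]; module
      _ = _ := by rw [hut, ← huτ]; module
  rw [e]
  exact (hC.starConvex_voronoiCell hr).add_smul_sub_mem hyr (by nlinarith) (by nlinarith)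

/-- The common point `x` of the cells of `p` and `q` is at least as close to `p` as to any other
site, so that no other site lies in the triangle `p q x`. -/
theorem not_memTriangle (hC : IsConvexBody C) {p q r x : Plane} (hp : p ∈ S) (hq : q ∈ S)
    (hr : r ∈ S) (hne : p ≠ q) (hrp : r ≠ p) (hrq : r ≠ q) (hxp : x ∈ voronoiCell C S p)
    (hxq : x ∈ voronoiCell C S q) : ¬ MemTriangle p q x r := by
  rintro ⟨α, β, γ, hα, hβ, hγ, hs, he⟩
  have heq := hC.convexDist_eq_of_mem hp hq hxp hxq
  have hpos := hC.convexDist_pos_of_mem hp hq hne hxp hxq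
  have hle := hC.voronoiCell_subset_nearestRegion S p hxp r hr
  simp only [hC.convexDist_eq_gauge] at heq hpos hle
  have hrx : r - x = α • (p - x) + β • (q - x) := by
    rw [← he]
    obtain rfl : γ = 1 - α - β := by linarith
    module
  have h := hC.gauge_add_le (α • (p - x)) (β • (q - x))
  rw [← hrx, gauge_smul_of_nonneg hα, gauge_smul_of_nonneg hβ, ← heq, smul_eq_mul,
    smul_eq_mul] at h
  -- The distance from `x` to `r` is at least that to `p`, but at most `α + β` times it; hence `α +
  -- β = 1`, and `r` is on the side `pq`.
  have hγ0 : γ = 0 := by nlinarith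
  subst hγ0
  refine hC.not_mem_openSegment hp hq hr hne hxp hxq
    (mem_openSegment_of_mem_segment ⟨α, β, hα, hβ, by linarith, ?_⟩ hrp hrq)
  rw [← he, zero_smul, add_zero]

theorem disjoint_openSegment (hC : IsConvexBody C) {p q r s x y : Plane} (hp : p ∈ S) (hq : q ∈ S)
    (hr : r ∈ S) (hs : s ∈ S) (hpq : p ≠ q) (hrs : r ≠ s) (hpr : p ≠ r) (hps : p ≠ s)
    (hqr : q ≠ r) (hqs : q ≠ s) (hxp : x ∈ voronoiCell C S p) (hxq : x ∈ voronoiCell C S q)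
    (hxr : x ∉ voronoiCell C S r) (hxs : x ∉ voronoiCell C S s) (hyr : y ∈ voronoiCell C S r)
    (hys : y ∈ voronoiCell C S s) (hyp : y ∉ voronoiCell C S p) (hyq : y ∉ voronoiCell C S q) :
    Disjoint (openSegment ℝ p q) (openSegment ℝ r s) := by
  rw [disjoint_left]
  intro z hz hz'
  by_cases hD : area (q - p) (s - r) = 0
  · obtain ⟨k, hk⟩ := exists_smul_eq_of_area_eq_zero hD (sub_ne_zero.2 hpq.symm)
    rcases endpoint_mem_of_openSegments_meet hk hz hz' with h | h | h
    · exact hC.not_mem_openSegment hr hs hq hrs hyr hys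
        (mem_openSegment_of_mem_segment h hqr hqs)
    · exact hC.not_mem_openSegment hp hq hs hpq hxp hxq
        (mem_openSegment_of_mem_segment h hps.symm hqs.symm)
    · exact hC.not_mem_openSegment hp hq hr hpq hxp hxq
        (mem_openSegment_of_mem_segment h hpr.symm hqr.symm)
  have hD' : area (p - z) (r - z) ≠ 0 := fun h => hD (by
    obtain ⟨b, -, hb, -⟩ := exists_neg_smul_of_mem_openSegment hz
    obtain ⟨d, -, hd, -⟩ := exists_neg_smul_of_mem_openSegment hz'
    have e1 : q - p = (-b - 1) • (p - z) := by rw [hb]; module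
    have e2 : s - r = (-d - 1) • (r - z) := by rw [hd]; module
    have e3 : area (q - p) (s - r) = (-b - 1) * (-d - 1) * area (p - z) (r - z) := by
      rw [e1, e2]; simp [area]; ring
    rw [e3, h, mul_zero])
  obtain ⟨u, hu | hu, hu' | hu'⟩ := polylines_meet x y hz hz' hD'
    (hC.not_memTriangle hp hq hr hpq hpr.symm hqr.symm hxp hxq)
    (hC.not_memTriangle hp hq hs hpq hps.symm hqs.symm hxp hxq)
    (hC.not_memTriangle hr hs hp hrs hpr hps hyr hys)
    (hC.not_memTriangle hr hs hq hrs hqr hqs hyr hys)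
  · exact disjoint_left.1 (hC.disjoint_segment hp hr hpr hxp hxr hyr hyp) hu hu'
  · exact disjoint_left.1 (hC.disjoint_segment hp hs hps hxp hxs hys hyp) hu hu'
  · exact disjoint_left.1 (hC.disjoint_segment hq hr hqr hxq hxr hyr hyq) hu hu'
  · exact disjoint_left.1 (hC.disjoint_segment hq hs hqs hxq hxs hys hyq) hu hu'

end IsConvexBody

/-! ### Delaunay edges and the conclusion. -/

/-- Adjacent sites have a point in common in their cells that lies in no other cell. -/
theorem exists_mem_voronoiCell_of_adj {p q : {p : Plane // p ∈ S}}
    (h : (delaunayGraph C S).Adj p q) :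
    ∃ x, x ∈ voronoiCell C S p ∧ x ∈ voronoiCell C S q ∧
      ∀ r ∈ S, r ≠ p → r ≠ q → x ∉ voronoiCell C S r := by
  obtain ⟨hne, e, ⟨x, hx, rfl⟩, hp, hq⟩ := h
  have hxe : x ∈ closure (connectedComponentIn (edgePoints C S) x) :=
    subset_closure (mem_connectedComponentIn hx)
  refine ⟨x, hp hxe, hq hxe, fun r hr hrp hrq hxr => ?_⟩
  have hfin : {p : Plane | p ∈ S ∧ x ∈ voronoiCell C S p}.Finite :=
    S.finite_toSet.subset fun _ h => h.1
  have hsub : ({r, p.1, q.1} : Set Plane) ⊆ {p : Plane | p ∈ S ∧ x ∈ voronoiCell C S p} := by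
    rintro _ (rfl | rfl | rfl)
    · exact ⟨hr, hxr⟩
    · exact ⟨p.2, hp hxe⟩
    · exact ⟨q.2, hq hxe⟩
  have hcard := Set.ncard_le_ncard hsub hfin
  rw [Set.ncard_eq_three.2 ⟨r, p.1, q.1, hrp, hrq, fun h => hne (Subtype.ext h), rfl⟩,
    show _ = 2 from hx] at hcard
  omega

/-- Segments with a common endpoint `p`, neither of which has the other endpoint of the other in
its relative interior, have no further point in common. -/
theorem disjoint_openSegment_segment_of_common_endpoint {p q s : Plane} (hqs : q ≠ s)
    (hpq : p ≠ q) (hq : q ∉ openSegment ℝ p s) (hs : s ∉ openSegment ℝ p q) :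
    Disjoint (openSegment ℝ p q) (segment ℝ p s) := by
  rw [disjoint_left]
  rintro z ⟨a, t, ha, ht, hat, rfl⟩ ⟨b, τ, hb, hτ, hbτ, he⟩
  obtain rfl : a = 1 - t := by linarith
  obtain rfl : b = 1 - τ := by linarith
  have he : τ • (s - p) = t • (q - p) := by
    have : τ • (s - p) = ((1 - τ) • p + τ • s) - p := by module
    rw [this, he]
    module
  have hτ : 0 < τ := hτ.lt_of_ne <| by
    rintro rfl
    rw [zero_smul, eq_comm, smul_eq_zero] at he
    exact he.elim ht.ne' (fun h => hpq (sub_eq_zero.1 h).symm)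
  rcases lt_trichotomy t τ with h | rfl | h
  · refine hs ⟨1 - t / τ, t / τ, by rw [sub_pos, div_lt_one hτ]; exact h, by positivity,
      by ring, ?_⟩
    have : s - p = (t / τ) • (q - p) := by
      rw [div_eq_inv_mul, mul_smul, ← he, smul_smul, inv_mul_cancel₀ hτ.ne', one_smul]
    rw [sub_eq_iff_eq_add'.1 this]
    module
  · exact hqs (sub_left_injective (smul_right_injective _ hτ.ne' he)).symm
  · refine hq ⟨1 - τ / t, τ / t, by rw [sub_pos, div_lt_one ht]; exact h, by positivity,
      by ring, ?_⟩
    have : q - p = (τ / t) • (s - p) := by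
      rw [div_eq_inv_mul, mul_smul, he, smul_smul, inv_mul_cancel₀ ht.ne', one_smul]
    rw [sub_eq_iff_eq_add'.1 this]
    module

theorem IsConvexBody.isPlaneGraph (hC : IsConvexBody C) (S : Finset Plane) :
    IsPlaneGraph (delaunayGraph C S) := by
  have vertex (p q : {p : Plane // p ∈ S}) (h : (delaunayGraph C S).Adj p q) (v : Plane)
      (hv : v ∈ S) : v ∉ openSegment ℝ p.1 q.1 := by
    obtain ⟨x, hxp, hxq, -⟩ := exists_mem_voronoiCell_of_adj h
    exact hC.not_mem_openSegment p.2 q.2 hv (fun e => h.ne (Subtype.ext e)) hxp hxq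
  refine ⟨vertex, fun p q r s hpq hrs hne => ?_⟩
  have common (p q s : {p : Plane // p ∈ S}) (hpq : (delaunayGraph C S).Adj p q)
      (hps : (delaunayGraph C S).Adj p s) (hqs : q ≠ s) :
      Disjoint (openSegment ℝ p.1 q.1) (segment ℝ p.1 s.1) :=
    disjoint_openSegment_segment_of_common_endpoint (fun e => hqs (Subtype.ext e))
      (fun e => hpq.ne (Subtype.ext e)) (vertex p s hps q q.2) (vertex p q hpq s s.2)
  -- Crossing paths need four distinct sites, so the shared endpoints are treated first.
  by_cases hpr : p = r
  · subst hpr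
    exact common p q s hpq hrs (by rintro rfl; exact hne rfl)
  by_cases hps : p = s
  · subst hps
    rw [segment_symm]
    exact common p q r hpq hrs.symm (by rintro rfl; exact hne Sym2.eq_swap)
  by_cases hqr : q = r
  · subst hqr
    rw [openSegment_symm]
    exact common q p s hpq.symm hrs (by rintro rfl; exact hne Sym2.eq_swap)
  by_cases hqs : q = s
  · subst hqs
    rw [openSegment_symm, segment_symm]
    exact common q p r hpq.symm hrs.symm (by rintro rfl; exact hne rfl)
  obtain ⟨x, hxp, hxq, hx⟩ := exists_mem_voronoiCell_of_adj hpq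
  obtain ⟨y, hyr, hys, hy⟩ := exists_mem_voronoiCell_of_adj hrs
  have val {a b : {p : Plane // p ∈ S}} (h : a ≠ b) : a.1 ≠ b.1 := fun e => h (Subtype.ext e)
  have hdisj := hC.disjoint_openSegment p.2 q.2 r.2 s.2 (val hpq.ne) (val hrs.ne) (val hpr)
    (val hps) (val hqr) (val hqs) hxp hxq (hx r r.2 (val hpr).symm (val hqr).symm)
    (hx s s.2 (val hps).symm (val hqs).symm) hyr hys (hy p p.2 (val hpr) (val hps))
    (hy q q.2 (val hqr) (val hqs))
  rw [disjoint_left] at hdisj ⊢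
  intro z hz hz'
  refine hdisj hz (mem_openSegment_of_mem_segment hz' ?_ ?_)
  · rintro rfl
    exact vertex p q hpq _ r.2 hz
  · rintro rfl
    exact vertex p q hpq _ s.2 hz

end ConvexDelaunay

theorem lemma3 (C : Set ConvexDelaunay.Plane) (hcompact : IsCompact C) (hconvex : Convex ℝ C)
    (hzero : (0 : ConvexDelaunay.Plane) ∈ interior C) (S : Finset ConvexDelaunay.Plane) :
    ConvexDelaunay.IsPlaneGraph (ConvexDelaunay.delaunayGraph C S) :=
  ConvexDelaunay.IsConvexBody.isPlaneGraph ⟨hcompact, hconvex, hzero⟩ S
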